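/- Let $\mathbb{F}$ be a field and let $\sigma:\mathbb{F}\to\mathbb{F}$ be a ring endomorphism of finite order $m\ge 1$, with fixed field $K=\{\beta\in\mathbb{F}:\sigma(\beta)=\beta\}$. Let $\mathbb{F}[x;\sigma]$ be the skew polynomial ring with $xc=\sigma(c)x$ for $c\in\mathbb{F}$ (that is, with derivation $\delta=0$). An element $b\in\mathbb F$ is a zero of $F\in\mathbb{F}[x;\sigma]$ if $x-b$ divides $F$ on the right, i.e. $F=G\cdot(x-b)$ for some $G$. For $a\in\mathbb{F}$ let $C(a)=\{\sigma(\beta)a\beta^{-1}:\beta\in\mathbb{F}^*\}$ be its conjugacy class, and let $N(a)=\prod_{i=0}^{m-1}\sigma^i(a)$. A sequence $(a_1,\dots,a_r)\in\mathbb{F}^r$, $r\ge1$, is a multiplicity sequence if $a_1$ is the only zero of $(x-a_r)\cdots(x-a_2)(x-a_1)$. An element $a\in\mathbb{F}$ is a zero of $F$ of multiplicity $r$ if there is a multiplicity sequence $(a_1,\dots,a_r)$ with $a_1=a$ such that $(x-a_r)\cdots(x-a_1)$ divides $F$ on the right. A set $B\subseteq\mathbb{F}$ is a P-basis of $C(a)$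 if $B\subseteq C(a)$; $B$ is finite and the least degree of a non-zero skew polynomial vanishing on $B$ equals $|B|$ (P-independence); and $C(a)$ is exactly the set of common zeros of all the skew polynomials that vanish on $B$. Let $F\in\mathbb{F}[x;\sigma]$. (A) Let $a\in\mathbb{F}^*$ and $r\ge1$. Then $(x^m-N(a))^r$ is central in $\mathbb{F}[x;\sigma]$ and lies in $K[x^m]$, and the following are equivalent: 1. every element of $C(a)$ is a zero of $F$ of multiplicity $r$; 2. every element of a P-basis of $C(a)$ is a zero of $F$ of multiplicity $r$ (equivalently for some P-basis, or for every P-basis); 3. $(x^m-N(a))^r$ divides $F$ (equivalently on the right or on the left). (B) Let $a_1,\dots,a_\ell\in\mathbb{F}^*$ be pairwise non-conjugate, let $r_1,\dots,r_\ell\ge1$, let $F\ne0$, and suppose that for each $i$ every element of $C(a_i)$ is a zero of $F$ of multiplicity $r_i$. Then $$m\sum_{i=1}^{\ell} r_i\le\deg(F),$$ and equality holds if and only if $F=b\prod_{i=1}^{\ell}(x^m-N(a_i))^{r_i}$ for some $b\in\mathbb{F}^*$. -/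

import Mathlib

open SkewPolynomial

namespace SkewMult

noncomputable section

variable {F : Type*} [Field F] [MulSemiringAction (Multiplicative ℕ) F]

/-- The degree of a skew polynomial, with `deg 0 = ⊥`. -/
def degree (p : SkewPolynomial F) : WithBot ℕ := p.support.max

/-- `p` is monic: non-zero with leading coefficient `1`. -/
def IsMonic (p : SkewPolynomial F) : Prop :=
  ∃ n : ℕ, degree p = n ∧ p.coeff n = 1

/-- `P` divides `f` on the right: `f = G * P` for some `G`. -/
def RightDvd (P f : SkewPolynomial F) : Prop := ∃ G : SkewPolynomial F, f = G * P

/-- The linear skew polynomial `x - a`. -/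
def linear (a : F) : SkewPolynomial F := X - C a

/-- `a` is a (right) zero of `f`: `x - a` divides `f` on the right. -/
def IsZero (f : SkewPolynomial F) (a : F) : Prop := RightDvd (linear a) f

/-- The set `{x - a | a ∈ S}` of evaluation points that is identified with `S ⊆ F`. -/
def linearSet (S : Set F) : Set (SkewPolynomial F) := linear '' S

/-- The universal set `{x - a | a ∈ F}` of classical evaluation points. -/
def classicalPoints : Set (SkewPolynomial F) := linearSet Set.univ

/-- The skew polynomials vanishing at (that is, right divisible by) all elements of `Ω`. -/
def vanishingIdeal (Ω : Set (SkewPolynomial F)) : Set (SkewPolynomial F) :=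
  {f | ∀ P ∈ Ω, RightDvd P f}

/-- The zeros in `U` of a set `A` of skew polynomials. -/
def zeroSet (U A : Set (SkewPolynomial F)) : Set (SkewPolynomial F) :=
  {P | P ∈ U ∧ ∀ f ∈ A, RightDvd P f}

/-- The relation `Ψ ≤ Ω`: the elements of any finite non-empty subset of `Ψ` divide on the right
as many distinct elements of `Ω`. -/
def SetLE (Ψ Ω : Set (SkewPolynomial F)) : Prop :=
  ∀ s : Finset (SkewPolynomial F), s.Nonempty → (s : Set (SkewPolynomial F)) ⊆ Ψ →
    ∃ g : SkewPolynomial F → SkewPolynomial F,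
      Set.InjOn g s ∧ ∀ Q ∈ s, g Q ∈ Ω ∧ RightDvd Q (g Q)

/-- `P` is the minimal skew polynomial of the algebraic set `Ω`: a monic element of least degree
among the non-zero skew polynomials vanishing at `Ω`. -/
def IsMinimalSkewPolynomial (Ω : Set (SkewPolynomial F)) (P : SkewPolynomial F) : Prop :=
  P ∈ vanishingIdeal Ω ∧ IsMonic P ∧
    ∀ Q ∈ vanishingIdeal Ω, Q ≠ 0 → degree P ≤ degree Q

/-- `Ω` is P-independent: finite, algebraic, and the degree of its minimal skew polynomial is the
sum of the degrees of the elements of `Ω`. -/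
def PIndependent (Ω : Set (SkewPolynomial F)) : Prop :=
  ∃ h : Ω.Finite, ∃ P : SkewPolynomial F,
    IsMinimalSkewPolynomial Ω P ∧ degree P = ∑ Q ∈ h.toFinset, degree Q

/-- The P-closure of `Ω` in `U`. -/
def pClosure (U Ω : Set (SkewPolynomial F)) : Set (SkewPolynomial F) :=
  zeroSet U (vanishingIdeal Ω)

/-- `B` is a P-basis of the P-closed set `Ω` (in the universal set `U`). -/
def IsPBasis (U Ω B : Set (SkewPolynomial F)) : Prop :=
  (Ω ⊆ U ∧ pClosure U Ω = Ω) ∧ (B ⊆ U ∧ SetLE B Ω) ∧ PIndependent B ∧ Ω = pClosure U B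

/-- The conjugacy class `C(a) = {σ(β) a β⁻¹ | β ≠ 0}`, where `σ = φ`. -/
def conjClass (a : F) : Set F := {b | ∃ β : F, β ≠ 0 ∧ b = φ β * a * β⁻¹}

/-- `B ⊆ F` is a P-basis of the conjugacy class `C(a)`. -/
def IsPBasisOfConjClass (a : F) (B : Set F) : Prop :=
  IsPBasis classicalPoints (linearSet (conjClass a)) (linearSet B)

/-- For `l = [a₁, a₂, …, aᵣ]`, the product `(x - aᵣ) ⋯ (x - a₂) (x - a₁)`. -/
def linearProd : List F → SkewPolynomial F
  | [] => 1
  | a :: l => linearProd l * linear a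

/-- `[a₁, …, aᵣ]` (with `r ≥ 1`) is a multiplicity sequence: `a₁` is the only zero of
`(x - aᵣ) ⋯ (x - a₁)`. -/
def IsMultiplicitySequence : List F → Prop
  | [] => False
  | a :: l => ∀ b : F, IsZero (linearProd (a :: l)) b ↔ b = a

/-- `a` is a zero of `f` of multiplicity `r` (via some multiplicity sequence of length `r` that
starts at `a`). -/
def IsZeroOfMultiplicity (f : SkewPolynomial F) (a : F) (r : ℕ) : Prop :=
  ∃ l : List F, l.length = r ∧ l.head? = some a ∧ IsMultiplicitySequence l ∧
    RightDvd (linearProd l) f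

/-- The norm `a σ(a) ⋯ σ^(m-1)(a)`, where `σ = φ`. -/
def norm (m : ℕ) (a : F) : F := ∏ i ∈ Finset.range m, φ^[i] a

/-- The skew polynomial `x^m - N(a)`. -/
def normPoly (m : ℕ) (a : F) : SkewPolynomial F := X ^ m - C (norm m a)

/-- The subring `K[x^m]`, where `K` is the fixed field of `σ = φ`. -/
def fixedPolySubring (F : Type*) [Field F] [MulSemiringAction (Multiplicative ℕ) F] (m : ℕ) :
    Subring (SkewPolynomial F) :=
  Subring.closure (insert (X ^ m) (C '' {β : F | φ β = β}))

end

end SkewMult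

namespace SkewMult

noncomputable section

set_option linter.unusedSectionVars false

variable {F : Type*} [Field F] [MulSemiringAction (Multiplicative ℕ) F]

/-! ### Degrees -/

/-! Let `X` act on `F` by `v ↦ a * φ v`. This action is linear over the fixed field `K`, and a
nonzero `β` is killed by `f` exactly when the conjugate of `a` by `β` is a zero of `f`. The kernel
of a nonzero `f` has `K`-dimension at most its degree, `F` has dimension `m` over `K`, and `p = x^m
- N(a)` acts as zero. Hence `p` divides `f` iff `f` acts as zero, iff `f` vanishes on all of `C(a)`.
Vanishing on the conjugates of `a` by a `K`-basis is already enough, which is why P-bases suffice.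

From multiplicity to divisibility by `p ^ r`, induct on `r`
(`pow_normPoly_rightDvd_of_unique_zero`). Write `f = g * p`. A product `P` attached to `c` that
divides `f` gives the generator `Q` of `{g | P divides g * p}`. Its degree is `deg P` minus that of
the greatest common right divisor (gcrd) of `p` and `P`. The gcrd divides `p` and has `c` as its
only zero, so it is linear. Thus `Q` has degree one less, inherits the single zero, and divides `g`.

Conversely, each `c` in `C(a)` starts a product of `r` linear factors dividing `p ^ r` but not `p ^
(r - 1)` (`exists_linearProd_rightDvd_pow`). A second zero would force it to divide `p ^ (r - 1)`
(`eq_of_isZero_of_not_rightDvd`), so it comes from a multiplicity sequence.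

For several classes, the polynomials `x^m - N(a_i)` are pairwise coprime in the commutative center,
so the product of their powers divides `f`; comparing degrees gives the bound and the equality case.
-/

theorem coeff_mul_eq_sum (f g : SkewPolynomial F) (n : ℕ) :
    (f * g).coeff n =
      ∑ p ∈ Finset.HasAntidiagonal.antidiagonal n, f.coeff p.1 * φ^[p.1] (g.coeff p.2) := by
  have h := SkewMonoidAlgebra.coeff_mul_antidiagonal_of_finset f g (Multiplicative.ofAdd n)
    ((Finset.HasAntidiagonal.antidiagonal n).map
      ⟨fun p => (Multiplicative.ofAdd p.1, Multiplicative.ofAdd p.2), fun p q h => by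
        simpa [Prod.ext_iff] using h⟩) (by
      rintro ⟨a, b⟩
      induction a with | ofAdd a
      induction b with | ofAdd b
      rw [Finset.mem_map]
      constructor
      · rintro ⟨⟨i, j⟩, h, h'⟩
        rw [Finset.HasAntidiagonal.mem_antidiagonal] at h
        rw [← h', ← h]
        rfl
      · intro h
        exact ⟨(a, b), Finset.HasAntidiagonal.mem_antidiagonal.2 h, rfl⟩)
  rw [Finset.sum_map] at h
  exact h.trans (Finset.sum_congr rfl fun p _ => by rw [φ_iterate_apply]; rfl)

/-- The skew polynomials all of whose coefficients of index at least `n` vanish. -/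
def degLT (F : Type*) [Field F] (n : ℕ) : Submodule F (SkewPolynomial F) where
  carrier := {f | ∀ k, n ≤ k → f.coeff k = 0}
  add_mem' hf hg k hk := by rw [coeff_add, hf k hk, hg k hk, add_zero]
  zero_mem' k _ := coeff_zero k
  smul_mem' c f hf k hk := by
    have : (c • f).coeff k = c * f.coeff k := rfl
    rw [this, hf k hk, mul_zero]

theorem iterate_φ_zero (n : ℕ) : φ^[n] (0 : F) = 0 := iterate_map_zero _ n

theorem iterate_φ_ne_zero (n : ℕ) {c : F} (hc : c ≠ 0) : φ^[n] c ≠ 0 := by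
  rw [← RingHom.coe_pow]; exact (map_ne_zero _).2 hc

theorem mul_mem_degLT {f g : SkewPolynomial F} {a b : ℕ} (hf : f ∈ degLT F (a + 1))
    (hg : g ∈ degLT F (b + 1)) : f * g ∈ degLT F (a + b + 1) := by
  intro k hk
  rw [coeff_mul_eq_sum]
  refine Finset.sum_eq_zero fun p hp => ?_
  rw [Finset.HasAntidiagonal.mem_antidiagonal] at hp
  by_cases h : a + 1 ≤ p.1
  · rw [hf _ h, zero_mul]
  · rw [hg _ (by omega), iterate_φ_zero, mul_zero]

theorem coeff_mul_add {f g : SkewPolynomial F} {a b : ℕ} (hf : f ∈ degLT F (a + 1))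
    (hg : g ∈ degLT F (b + 1)) :
    (f * g).coeff (a + b) = f.coeff a * φ^[a] (g.coeff b) := by
  rw [coeff_mul_eq_sum, Finset.sum_eq_single (a, b)]
  · intro p hp hne
    rw [Finset.HasAntidiagonal.mem_antidiagonal] at hp
    by_cases h : a + 1 ≤ p.1
    · rw [hf _ h, zero_mul]
    · have : p.1 ≠ a := fun h' => hne (Prod.ext h' (by simp only; omega))
      rw [hg _ (by omega), iterate_φ_zero, mul_zero]
  · intro h
    exact absurd (Finset.HasAntidiagonal.mem_antidiagonal (n := a + b).2 rfl) h

/-- The degree of a skew polynomial as a natural number, with value `0` at `0`. -/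
def natDeg (f : SkewPolynomial F) : ℕ := (degree f).unbotD 0

theorem degree_eq_natDeg {f : SkewPolynomial F} (hf : f ≠ 0) : degree f = natDeg f := by
  obtain ⟨n, hn⟩ := Finset.max_of_nonempty
    (Finset.nonempty_iff_ne_empty.2 (mt support_eq_empty.1 hf))
  simp only [natDeg, degree, hn]
  rfl

theorem degree_zero : degree (0 : SkewPolynomial F) = ⊥ := by
  simp [degree]

theorem natDeg_zero : natDeg (0 : SkewPolynomial F) = 0 := by
  simp [natDeg, degree_zero]

theorem le_natDeg {f : SkewPolynomial F} {n : ℕ} (h : f.coeff n ≠ 0) : n ≤ natDeg f := by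
  have hf : f ≠ 0 := by rintro rfl; exact h (coeff_zero n)
  have := Finset.le_max (mem_support_iff.2 h)
  change _ ≤ degree f at this
  rw [degree_eq_natDeg hf] at this
  exact WithBot.coe_le_coe.1 this

theorem coeff_natDeg_ne_zero {f : SkewPolynomial F} (hf : f ≠ 0) : f.coeff (natDeg f) ≠ 0 :=
  mem_support_iff.1 (Finset.mem_of_max (degree_eq_natDeg hf))

theorem mem_degLT_natDeg_succ (f : SkewPolynomial F) : f ∈ degLT F (natDeg f + 1) := by
  intro k hk
  by_contra h
  have := le_natDeg h
  omega

theorem natDeg_lt_of_mem_degLT {f : SkewPolynomial F} {n : ℕ} (hf : f ≠ 0)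
    (h : f ∈ degLT F n) : natDeg f < n := by
  by_contra hn
  exact coeff_natDeg_ne_zero hf (h _ (by omega))

theorem natDeg_eq {f : SkewPolynomial F} {n : ℕ} (h : f ∈ degLT F (n + 1))
    (hn : f.coeff n ≠ 0) : natDeg f = n := by
  have hf : f ≠ 0 := by rintro rfl; exact hn (coeff_zero n)
  have := natDeg_lt_of_mem_degLT hf h
  have := le_natDeg hn
  omega

theorem coeff_mul_natDeg_ne_zero {f g : SkewPolynomial F} (hf : f ≠ 0) (hg : g ≠ 0) :
    (f * g).coeff (natDeg f + natDeg g) ≠ 0 := by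
  rw [coeff_mul_add (mem_degLT_natDeg_succ f) (mem_degLT_natDeg_succ g)]
  exact mul_ne_zero (coeff_natDeg_ne_zero hf) (iterate_φ_ne_zero _ (coeff_natDeg_ne_zero hg))

instance : NoZeroDivisors (SkewPolynomial F) where
  eq_zero_or_eq_zero_of_mul_eq_zero {f g} h := by
    by_contra! hc
    apply coeff_mul_natDeg_ne_zero hc.1 hc.2
    rw [h, coeff_zero]

theorem natDeg_mul {f g : SkewPolynomial F} (hf : f ≠ 0) (hg : g ≠ 0) :
    natDeg (f * g) = natDeg f + natDeg g :=
  natDeg_eq (mul_mem_degLT (mem_degLT_natDeg_succ f) (mem_degLT_natDeg_succ g))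
    (coeff_mul_natDeg_ne_zero hf hg)

theorem natDeg_C (c : F) : natDeg (C c) = 0 := by
  by_cases hc : c = 0
  · rw [hc, C_0, natDeg_zero]
  · refine natDeg_eq (fun k hk => coeff_C_ne_zero (by omega)) ?_
    rwa [coeff_C_zero]

theorem natDeg_one : natDeg (1 : SkewPolynomial F) = 0 := natDeg_C 1

theorem eq_C_of_natDeg_eq_zero {f : SkewPolynomial F} (h : natDeg f = 0) : f = C (f.coeff 0) := by
  refine SkewPolynomial.ext fun n => ?_
  rcases n with _ | n
  · rw [coeff_C_zero]
  · rw [coeff_C_succ]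
    exact mem_degLT_natDeg_succ f _ (by omega)

theorem linear_coeff_one (a : F) : (linear a).coeff 1 = 1 := by
  simp [linear]

theorem linear_ne_zero (a : F) : linear a ≠ 0 := fun h => by
  have := linear_coeff_one a
  rw [h, coeff_zero] at this
  exact zero_ne_one this

theorem natDeg_linear (a : F) : natDeg (linear a) = 1 := by
  refine natDeg_eq (fun k hk => ?_) ?_
  · rw [linear, coeff_sub, coeff_X_of_ne_one (by omega), coeff_C_ne_zero (by omega), sub_zero]
  · rw [linear_coeff_one]; exact one_ne_zero

theorem linear_injective : Function.Injective (linear : F → SkewPolynomial F) := fun a b h => by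
  simpa [linear] using h

theorem normPoly_coeff {m : ℕ} (hm : 0 < m) (a : F) : (normPoly m a).coeff m = 1 := by
  rw [normPoly, coeff_sub, X_pow_eq_monomial, coeff_monomial, if_pos rfl,
    coeff_C_ne_zero hm.ne', sub_zero]

theorem natDeg_normPoly {m : ℕ} (hm : 0 < m) (a : F) : natDeg (normPoly m a) = m := by
  refine natDeg_eq (fun k hk => ?_) (by rw [normPoly_coeff hm]; exact one_ne_zero)
  rw [normPoly, coeff_sub, X_pow_eq_monomial, coeff_monomial, if_neg (by omega),
    coeff_C_ne_zero (by omega), sub_zero]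

theorem normPoly_ne_zero {m : ℕ} (hm : 0 < m) (a : F) : normPoly m a ≠ 0 := fun h => by
  have := normPoly_coeff hm a
  rw [h, coeff_zero] at this
  exact zero_ne_one this

theorem natDeg_pow {f : SkewPolynomial F} (hf : f ≠ 0) (n : ℕ) :
    natDeg (f ^ n) = n * natDeg f := by
  induction n with
  | zero => rw [pow_zero, natDeg_one, zero_mul]
  | succ n ih => rw [pow_succ, natDeg_mul (pow_ne_zero n hf) hf, ih, Nat.succ_mul]

/-! ### Division and left ideals -/

theorem exists_eq_mul_add {g : SkewPolynomial F} (hg : g ≠ 0) (f : SkewPolynomial F) :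
    ∃ q r, f = q * g + r ∧ r ∈ degLT F (natDeg g) := by
  suffices h : ∀ n, ∀ f ∈ degLT F n, ∃ q r, f = q * g + r ∧ r ∈ degLT F (natDeg g) from
    h _ f (mem_degLT_natDeg_succ f)
  intro n
  induction n with
  | zero =>
    intro f hf
    exact ⟨0, f, by simp, fun k _ => hf k (Nat.zero_le k)⟩
  | succ n ih =>
    intro f hf
    by_cases hn : n < natDeg g
    · exact ⟨0, f, by simp, fun k hk => hf k (by omega)⟩
    obtain ⟨i, rfl⟩ := Nat.exists_eq_add_of_le' (not_lt.1 hn)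
    -- Moving `x^i` past a coefficient applies `φ^[i]`, so the leading coefficient of `g` must be
    -- twisted before dividing by it.
    set u := monomial i (f.coeff (i + natDeg g) / φ^[i] (g.coeff (natDeg g))) with hu
    have hu1 : u ∈ degLT F (i + 1) := fun k hk => by
      rw [hu, coeff_monomial, if_neg (by omega)]
    have hlt : f - u * g ∈ degLT F (i + natDeg g) := by
      intro k hk
      rcases hk.eq_or_lt with rfl | hk
      · rw [coeff_sub, coeff_mul_add hu1 (mem_degLT_natDeg_succ g), hu, coeff_monomial,
          if_pos rfl, div_mul_cancel₀ _ (iterate_φ_ne_zero _ (coeff_natDeg_ne_zero hg)), sub_self]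
      · rw [coeff_sub, hf k hk, mul_mem_degLT hu1 (mem_degLT_natDeg_succ g) k hk, sub_zero]
    obtain ⟨q, r, h1, h2⟩ := ih _ hlt
    exact ⟨q + u, r, by rw [add_mul, add_right_comm, ← h1, sub_add_cancel], h2⟩

theorem rightDvd_iff_mem_span {P f : SkewPolynomial F} :
    RightDvd P f ↔ f ∈ Ideal.span {P} := by
  rw [Ideal.mem_span_singleton']
  exact exists_congr fun _ => eq_comm

theorem RightDvd.refl (P : SkewPolynomial F) : RightDvd P P := ⟨1, (one_mul P).symm⟩

theorem RightDvd.trans {P Q f : SkewPolynomial F} (h₁ : RightDvd P Q) (h₂ : RightDvd Q f) :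
    RightDvd P f := by
  obtain ⟨G, rfl⟩ := h₁
  obtain ⟨H, rfl⟩ := h₂
  exact ⟨H * G, (mul_assoc _ _ _).symm⟩

theorem RightDvd.mul_left {P f : SkewPolynomial F} (h : RightDvd P f) (g : SkewPolynomial F) :
    RightDvd P (g * f) := by
  obtain ⟨G, rfl⟩ := h
  exact ⟨g * G, (mul_assoc _ _ _).symm⟩

theorem RightDvd.add {P f g : SkewPolynomial F} (hf : RightDvd P f) (hg : RightDvd P g) :
    RightDvd P (f + g) := by
  obtain ⟨G, rfl⟩ := hf
  obtain ⟨H, rfl⟩ := hg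
  exact ⟨G + H, (add_mul _ _ _).symm⟩

theorem ne_zero_of_rightDvd {P f : SkewPolynomial F} (h : RightDvd P f) (hf : f ≠ 0) : P ≠ 0 := by
  obtain ⟨G, rfl⟩ := h
  exact right_ne_zero_of_mul hf

theorem natDeg_le_of_rightDvd {P f : SkewPolynomial F} (h : RightDvd P f) (hf : f ≠ 0) :
    natDeg P ≤ natDeg f := by
  obtain ⟨G, rfl⟩ := h
  rw [natDeg_mul (left_ne_zero_of_mul hf) (right_ne_zero_of_mul hf)]
  omega

theorem eq_zero_of_rightDvd_of_mem_degLT {P f : SkewPolynomial F} (h : RightDvd P f)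
    (hf : f ∈ degLT F (natDeg P)) : f = 0 := by
  by_contra hne
  have := natDeg_le_of_rightDvd h hne
  have := natDeg_lt_of_mem_degLT hne hf
  omega

theorem rightDvd_of_natDeg_eq_zero {P : SkewPolynomial F} (hP : P ≠ 0) (h : natDeg P = 0)
    (f : SkewPolynomial F) : RightDvd P f := by
  have hc : P.coeff 0 ≠ 0 := h ▸ coeff_natDeg_ne_zero hP
  refine ⟨f * C (P.coeff 0)⁻¹, ?_⟩
  conv_rhs => rw [eq_C_of_natDeg_eq_zero h, coeff_C_zero]
  rw [mul_assoc, ← C_mul, inv_mul_cancel₀ hc, C_1, mul_one]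

/-- A right divisor of the same degree is an associate. -/
theorem rightDvd_symm {P f : SkewPolynomial F} (h : RightDvd P f) (hf : f ≠ 0)
    (hd : natDeg f ≤ natDeg P) : RightDvd f P := by
  obtain ⟨G, rfl⟩ := h
  have hG := left_ne_zero_of_mul hf
  rw [natDeg_mul hG (right_ne_zero_of_mul hf)] at hd
  obtain ⟨H, hH⟩ := rightDvd_of_natDeg_eq_zero hG (by omega) 1
  exact ⟨H, by rw [← mul_assoc, ← hH, one_mul]⟩

theorem natDeg_eq_zero_of_rightDvd_one {P : SkewPolynomial F} (h : RightDvd P 1) :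
    natDeg P = 0 := by
  have := natDeg_le_of_rightDvd h one_ne_zero
  rw [natDeg_one] at this
  omega

/-- Every left ideal is principal. -/
theorem exists_eq_span_singleton (I : Ideal (SkewPolynomial F)) :
    ∃ P, I = Ideal.span {P} := by
  by_cases hI : ∃ f ∈ I, f ≠ 0
  · classical
    have hex : ∃ n, ∃ f ∈ I, f ≠ 0 ∧ natDeg f = n := by
      obtain ⟨f, hf, hf0⟩ := hI
      exact ⟨_, f, hf, hf0, rfl⟩
    obtain ⟨P, hP, hP0, hPd⟩ := Nat.find_spec hex
    refine ⟨P, le_antisymm (fun f hf => ?_) ((Ideal.span_singleton_le_iff_mem _).2 hP)⟩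
    obtain ⟨q, r, h1, h2⟩ := exists_eq_mul_add hP0 f
    have hr : r ∈ I := by
      rw [← sub_eq_iff_eq_add'.2 h1]
      exact sub_mem hf (I.mul_mem_left q hP)
    have hr0 : r = 0 := by
      by_contra hne
      have := Nat.find_min' hex ⟨r, hr, hne, rfl⟩
      have := natDeg_lt_of_mem_degLT hne h2
      omega
    rw [Ideal.mem_span_singleton']
    exact ⟨q, by rw [h1, hr0, add_zero]⟩
  · push Not at hI
    refine ⟨0, ?_⟩
    rw [Ideal.span_singleton_zero, eq_bot_iff]
    exact fun f hf => hI f hf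

/-- A right greatest common divisor, with Bézout coefficients. -/
theorem exists_gcrd (f g : SkewPolynomial F) :
    ∃ D, RightDvd D f ∧ RightDvd D g ∧ ∃ u v, D = u * f + v * g := by
  obtain ⟨D, hD⟩ := exists_eq_span_singleton (Ideal.span {f, g})
  refine ⟨D, ?_, ?_, ?_⟩
  · rw [rightDvd_iff_mem_span, ← hD]
    exact Ideal.subset_span (by simp)
  · rw [rightDvd_iff_mem_span, ← hD]
    exact Ideal.subset_span (by simp)
  · have : D ∈ Ideal.span {f, g} := hD ▸ Ideal.mem_span_singleton_self D
    obtain ⟨u, v, h⟩ := Ideal.mem_span_pair.1 this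
    exact ⟨u, v, h.symm⟩

/-- Remainders of degree below `natDeg P` represent each class exactly once. Degrees thus become
dimensions, so rank-nullity can replace computations with gcrds. -/
theorem finrank_quotient_span {P : SkewPolynomial F} (hP : P ≠ 0) :
    Module.finrank F (SkewPolynomial F ⧸ Ideal.span {P}) = natDeg P ∧
      Module.Finite F (SkewPolynomial F ⧸ Ideal.span {P}) := by
  set d := natDeg P
  let e : (Fin d → F) →ₗ[F] SkewPolynomial F :=
    ∑ i : Fin d, (monomial (i : ℕ)).comp (LinearMap.proj i)
  have he : ∀ (v : Fin d → F) (k : ℕ), (e v).coeff k = if h : k < d then v ⟨k, h⟩ else 0 := by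
    intro v k
    have h1 : e v = ∑ i : Fin d, monomial (i : ℕ) (v i) := by simp [e]
    have h2 : ∀ s : Finset (Fin d), (∑ i ∈ s, monomial (i : ℕ) (v i)).coeff k =
        ∑ i ∈ s, if (i : ℕ) = k then v i else 0 := by
      classical
      intro s
      induction s using Finset.induction_on with
      | empty => simp
      | insert i s hi ih => rw [Finset.sum_insert hi, Finset.sum_insert hi, coeff_add, ih,
          coeff_monomial]
    rw [h1, h2]
    split_ifs with h
    · rw [Finset.sum_eq_single ⟨k, h⟩, if_pos rfl]
      · exact fun b _ hb => if_neg fun h' => hb (Fin.ext h')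
      · exact fun h' => absurd (Finset.mem_univ _) h'
    · refine Finset.sum_eq_zero fun i _ => if_neg (by have := i.2; omega)
  let q : SkewPolynomial F →ₗ[F] SkewPolynomial F ⧸ Ideal.span {P} :=
    (Ideal.span {P}).mkQ.restrictScalars F
  have hq : ∀ f, q f = 0 ↔ RightDvd P f := fun f => by
    rw [rightDvd_iff_mem_span]
    exact Submodule.Quotient.mk_eq_zero _
  have hbij : Function.Bijective (q.comp e) := by
    constructor
    · rw [← LinearMap.ker_eq_bot, LinearMap.ker_eq_bot']
      intro v hv
      have h0 := eq_zero_of_rightDvd_of_mem_degLT ((hq _).1 hv) (fun k hk => by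
        rw [he, dif_neg (by omega)])
      funext i
      have := he v i
      rw [h0, coeff_zero, dif_pos i.2] at this
      exact this.symm
    · intro y
      obtain ⟨f, rfl⟩ := Submodule.mkQ_surjective _ y
      obtain ⟨s, r, h1, h2⟩ := exists_eq_mul_add hP f
      refine ⟨fun i => r.coeff i, ?_⟩
      have her : e (fun i => r.coeff i) = r := SkewPolynomial.ext fun k => by
        rw [he]
        split_ifs with h
        · rfl
        · exact (h2 k (by omega)).symm
      change q (e _) = q f
      rw [her, h1, map_add, (hq _).2 ⟨s, rfl⟩, zero_add]
  let E := LinearEquiv.ofBijective (q.comp e) hbij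
  exact ⟨by rw [← E.finrank_eq, Module.finrank_fin_fun], Module.Finite.equiv E⟩

/-- The left ideal `{g | g * h ∈ R * P}`: its generator has degree `deg P - deg D`, where `D` is
the greatest common right divisor of `h` and `P`. -/
theorem exists_colon {P : SkewPolynomial F} (hP : P ≠ 0) (h : SkewPolynomial F) :
    ∃ Q, Q ≠ 0 ∧ (∀ g, RightDvd Q g ↔ RightDvd P (g * h)) ∧
      ∀ D, RightDvd D h → RightDvd D P → (∃ u v, D = u * h + v * P) →
        natDeg Q + natDeg D = natDeg P := by
  set M := SkewPolynomial F ⧸ Ideal.span {P}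
  let T : SkewPolynomial F →ₗ[SkewPolynomial F] M :=
    (Ideal.span {P}).mkQ.comp (LinearMap.toSpanSingleton (SkewPolynomial F) (SkewPolynomial F) h)
  have hT : ∀ g, T g = 0 ↔ RightDvd P (g * h) := fun g => by
    rw [rightDvd_iff_mem_span]
    exact Submodule.Quotient.mk_eq_zero _
  obtain ⟨Q, hQ⟩ := exists_eq_span_singleton (LinearMap.ker T)
  have hQg : ∀ g, RightDvd Q g ↔ RightDvd P (g * h) := fun g => by
    rw [rightDvd_iff_mem_span, ← hQ, LinearMap.mem_ker, hT]
  obtain ⟨hfr, hfin⟩ := finrank_quotient_span hP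
  -- Otherwise the infinite-dimensional ring of skew polynomials would embed in the
  -- finite-dimensional quotient by `P`.
  have hQ0 : Q ≠ 0 := by
    rintro rfl
    have hinj : Function.Injective (T.restrictScalars F) := by
      rw [← LinearMap.ker_eq_bot, LinearMap.ker_eq_bot']
      intro g hg
      obtain ⟨G, hG⟩ := (hQg g).2 ((hT g).1 hg)
      rw [hG, mul_zero]
    have := Module.Finite.of_injective _ hinj
    have := Module.Finite.finite_basis (SkewMonoidAlgebra.basisSingleOne (k := F) (G := Multiplicative ℕ))
    exact not_finite (Multiplicative ℕ)
  refine ⟨Q, hQ0, hQg, fun D hDh hDP ⟨u, v, huv⟩ => ?_⟩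
  have hD0 := ne_zero_of_rightDvd hDP hP
  obtain ⟨hfrD, hfinD⟩ := finrank_quotient_span hD0
  obtain ⟨hfrQ, hfinQ⟩ := finrank_quotient_span hQ0
  let π : M →ₗ[SkewPolynomial F] SkewPolynomial F ⧸ Ideal.span {D} :=
    Submodule.factor ((Ideal.span_singleton_le_iff_mem _).2 (rightDvd_iff_mem_span.1 hDP))
  have hπ : Function.Surjective π := Submodule.factor_surjective _
  have hker : LinearMap.ker π = LinearMap.range T := by
    ext y
    obtain ⟨f, rfl⟩ := Submodule.mkQ_surjective _ y
    rw [LinearMap.mem_ker, LinearMap.mem_range]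
    have h1 : π ((Ideal.span {P}).mkQ f) = 0 ↔ RightDvd D f := by
      rw [rightDvd_iff_mem_span]
      exact Submodule.Quotient.mk_eq_zero _
    rw [h1]
    constructor
    · rintro ⟨G, rfl⟩
      refine ⟨G * u, ?_⟩
      refine (Submodule.Quotient.eq _).2 (rightDvd_iff_mem_span.1 ⟨-(G * v), ?_⟩)
      simp only [LinearMap.toSpanSingleton_apply, smul_eq_mul, huv]
      noncomm_ring
    · rintro ⟨g, hg⟩
      have h2 := rightDvd_iff_mem_span.2 ((Submodule.Quotient.eq _).1 hg)
      simp only [LinearMap.toSpanSingleton_apply, smul_eq_mul] at h2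
      have h3 := hDP.trans h2
      obtain ⟨G, hG⟩ := h3
      obtain ⟨H, rfl⟩ := hDh
      exact ⟨g * H - G, by rw [sub_mul, ← hG, mul_assoc]; abel⟩
  -- With `R` the skew polynomial ring, `R/RQ ≅ (Rh + RP)/RP = RD/RP`, the kernel of `R/RP → R/RD`;
  -- its dimension is `deg P - deg D`.
  have e1 : (SkewPolynomial F ⧸ Ideal.span {Q}) ≃ₗ[SkewPolynomial F] LinearMap.ker π :=
    (Submodule.quotEquivOfEq _ _ hQ.symm).trans
      (T.quotKerEquivRange.trans (LinearEquiv.ofEq _ _ hker.symm))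
  have e2 := (e1.restrictScalars F).finrank_eq
  have e3 := LinearMap.finrank_range_add_finrank_ker (π.restrictScalars F)
  have e5 : LinearMap.range (π.restrictScalars F) = ⊤ := LinearMap.range_eq_top.2 hπ
  rw [e5, finrank_top, hfrD, hfr] at e3
  have e4 : Module.finrank F (LinearMap.ker π) =
    Module.finrank F (LinearMap.ker (π.restrictScalars F)) := rfl
  omega

theorem eq_of_isZero_linear {b c : F} (hc : IsZero (linear b) c) : c = b := by
  obtain ⟨G, hG⟩ := hc
  apply linear_injective
  have h3 := linear_ne_zero b
  have h4 := natDeg_linear b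
  rw [hG] at h3
  rw [hG, natDeg_mul (left_ne_zero_of_mul h3) (linear_ne_zero _), natDeg_linear] at h4
  have h5 := eq_C_of_natDeg_eq_zero (f := G) (by omega)
  have h6 := linear_coeff_one b
  rw [hG, h5, linear, mul_sub, coeff_sub, ← C_mul, C_mul_X_eq_monomial, coeff_monomial, if_pos rfl,
    coeff_C_succ (n := 0), sub_zero] at h6
  rw [hG, h5, h6, C_1, one_mul]

/-! ### The fixed field -/

/-- The fixed field of `φ`. -/
def fixedField (F : Type*) [Field F] [MulSemiringAction (Multiplicative ℕ) F] : Subfield F :=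
  (φ : F →+* F).eqLocusField (RingHom.id F)

theorem mem_fixedField {x : F} : x ∈ fixedField F ↔ φ x = x := Iff.rfl

theorem iterate_φ_orderOf (x : F) : φ^[orderOf (φ : F →+* F)] x = x := by
  rw [← RingHom.coe_pow, pow_orderOf_eq_one]; rfl

/-- Finite order makes `φ` an automorphism with inverse `φ^[m - 1]`, so Artin's theorem applies to
the cyclic group it generates. -/
theorem finrank_fixedField (h : 0 < orderOf (φ : F →+* F)) :
    Module.Finite (fixedField F) F ∧
      Module.finrank (fixedField F) F = orderOf (φ : F →+* F) := by
  classical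
  set m := orderOf (φ : F →+* F)
  have hbij : Function.Bijective (φ : F → F) := by
    refine ⟨(φ : F →+* F).injective, fun y => ⟨φ^[m - 1] y, ?_⟩⟩
    rw [← Function.iterate_succ_apply' φ, Nat.succ_eq_add_one, Nat.sub_add_cancel h,
      iterate_φ_orderOf]
  let e : F ≃+* F := RingEquiv.ofBijective φ hbij
  have hpow : ∀ n : ℕ, ∀ x, (e ^ n) x = φ^[n] x := by
    intro n
    induction n with
    | zero => intro x; rfl
    | succ n ih =>
      intro x
      rw [pow_succ', Function.iterate_succ_apply', ← ih]; rfl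
  have hord : orderOf e = m := by
    refine orderOf_eq_orderOf_iff.2 fun n => ?_
    constructor
    · intro hn
      ext x
      have := congrArg (fun f : F ≃+* F => f x) hn
      simp only [hpow] at this
      rw [RingHom.coe_pow, this]; rfl
    · intro hn
      ext x
      rw [hpow, ← RingHom.coe_pow, hn]; rfl
  let G := Subgroup.zpowers e
  have hcard : Nat.card G = m := by rw [Nat.card_zpowers, hord]
  have : Finite G := Nat.finite_of_card_ne_zero (by omega)
  have : Fintype G := Fintype.ofFinite G
  have hK : fixedField F = FixedPoints.subfield G F := by
    ext x
    rw [mem_fixedField]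
    constructor
    · rintro hx ⟨g, n, rfl⟩
      have hs : e ∈ MulAction.stabilizer (F ≃+* F) x := hx
      exact Subgroup.zpow_mem _ hs n
    · intro hx
      exact hx ⟨e, Subgroup.mem_zpowers e⟩
  rw [hK]
  exact ⟨inferInstance, by rw [FixedPoints.finrank_eq_card, ← Nat.card_eq_fintype_card, hcard]⟩

/-! ### The action of skew polynomials on the field -/

/-- The semilinear map `v ↦ a * φ v`. -/
def twist (a : F) : F →ₗ[fixedField F] F where
  toFun v := a * φ v
  map_add' v w := by rw [map_add, mul_add]
  map_smul' c v := by
    rw [RingHom.id_apply, Subfield.smul_def, Subfield.smul_def, smul_eq_mul, smul_eq_mul, map_mul,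
      mem_fixedField.1 c.2, mul_left_comm]

theorem twist_apply (a v : F) : twist a v = a * φ v := rfl

theorem lmul_mul_twist_pow (a x : F) (n : ℕ) :
    Algebra.lmul (fixedField F) F (φ^[n] x) * twist a ^ n =
      twist a ^ n * Algebra.lmul (fixedField F) F x := by
  induction n with
  | zero => rw [pow_zero, one_mul, mul_one]; rfl
  | succ n ih =>
    rw [pow_succ', mul_assoc, ← ih, ← mul_assoc, ← mul_assoc, Function.iterate_succ_apply']
    congr 1
    ext v
    simp only [Module.End.mul_apply, twist_apply, Algebra.coe_lmul_eq_mul, LinearMap.mul_apply',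
      map_mul]
    ring

/-- The action of skew polynomials on `F` where `X` acts as `v ↦ a * φ v`. -/
def act (a : F) : SkewPolynomial F →+* Module.End (fixedField F) F :=
  SkewMonoidAlgebra.liftNCRingHom (Algebra.lmul (fixedField F) F : F →+* _)
    (powersHom _ (twist a)) (by
      intro x y
      induction y with | ofAdd n
      rw [← φ_iterate_apply]
      simpa using lmul_mul_twist_pow a x n)

theorem act_monomial (a c v : F) (n : ℕ) :
    act a (monomial n c) v = c * (twist a ^ n) v := by
  have : act a (monomial n c) = Algebra.lmul (fixedField F) F c * twist a ^ n :=
    SkewMonoidAlgebra.liftNC_single _ _ _ _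
  rw [this]; rfl

theorem act_X (a v : F) : act a X v = a * φ v := by
  rw [← monomial_one_one_eq_X, act_monomial, one_mul, pow_one, twist_apply]

theorem act_C (a c v : F) : act a (C c) v = c * v := by
  rw [← monomial_zero_left, act_monomial, pow_zero]; rfl

theorem act_linear (a b v : F) : act a (linear b) v = a * φ v - b * v := by
  rw [linear, map_sub, LinearMap.sub_apply, act_X, act_C]

theorem act_X_pow (a v : F) (n : ℕ) : act a (X ^ n) v = norm n a * φ^[n] v := by
  rw [map_pow]
  induction n generalizing v with
  | zero => simp [norm]
  | succ n ih =>
    rw [pow_succ, Module.End.mul_apply, ih, act_X, norm, norm, Finset.prod_range_succ,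
      Function.iterate_succ_apply, iterate_map_mul, mul_assoc]

theorem act_normPoly (a : F) : act a (normPoly (orderOf (φ : F →+* F)) a) = 0 := by
  ext v
  rw [normPoly, map_sub, LinearMap.sub_apply, act_X_pow, act_C, iterate_φ_orderOf, sub_self]
  rfl

/-- `β` is annihilated by `f` exactly when the conjugate of `a` by `β` is a zero of `f`. -/
theorem act_eq_zero_iff (a : F) {β : F} (hβ : β ≠ 0) (f : SkewPolynomial F) :
    act a f β = 0 ↔ IsZero f (φ β * a * β⁻¹) := by
  have h0 : act a (linear (φ β * a * β⁻¹)) β = 0 := by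
    rw [act_linear, inv_mul_cancel_right₀ hβ, mul_comm, sub_self]
  constructor
  · intro h
    obtain ⟨q, r, rfl, h2⟩ := exists_eq_mul_add (linear_ne_zero (φ β * a * β⁻¹)) f
    rw [natDeg_linear] at h2
    have hr : r = C (r.coeff 0) := SkewPolynomial.ext fun n => by
      rcases n with _ | n
      · rw [coeff_C_zero]
      · rw [coeff_C_succ, h2 _ (by omega)]
    rw [map_add, map_mul, LinearMap.add_apply, Module.End.mul_apply, h0, map_zero, zero_add,
      hr, act_C] at h
    have hc := (mul_eq_zero.1 h).resolve_right hβ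
    rw [hr, hc, C_0, add_zero]
    exact ⟨q, rfl⟩
  · rintro ⟨G, rfl⟩
    rw [map_mul, Module.End.mul_apply, h0, map_zero]

/-- The quotient of two nonzero solutions of `a * φ v = b * v` is fixed by `φ`, because `a ≠ 0`. -/
theorem finrank_ker_act_linear_le (a b : F) (ha : a ≠ 0) :
    Module.finrank (fixedField F) (LinearMap.ker (act a (linear b))) ≤ 1 := by
  by_cases hex : ∃ β ∈ LinearMap.ker (act a (linear b)), β ≠ 0
  · obtain ⟨β, hβ, hβ0⟩ := hex
    rw [LinearMap.mem_ker, act_linear, sub_eq_zero] at hβ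
    refine finrank_le_one ⟨β, by rw [LinearMap.mem_ker, act_linear, sub_eq_zero, hβ]⟩ ?_
    rintro ⟨v, hv⟩
    rw [LinearMap.mem_ker, act_linear, sub_eq_zero] at hv
    have hφβ : φ β ≠ 0 := (map_ne_zero _).2 hβ0
    have hfix : φ (v / β) = v / β := by
      rw [map_div₀, div_eq_div_iff hφβ hβ0]
      apply mul_left_cancel₀ ha
      linear_combination β * hv - v * hβ
    refine ⟨⟨v / β, hfix⟩, Subtype.ext ?_⟩
    exact div_mul_cancel₀ v hβ0
  · push Not at hex
    have : LinearMap.ker (act a (linear b)) = ⊥ := by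
      rw [eq_bot_iff]
      exact fun v hv => hex v hv
    rw [this, finrank_bot]
    exact Nat.zero_le 1

theorem finrank_ker_mul_le {K V : Type*} [Field K] [AddCommGroup V] [Module K V]
    [Module.Finite K V] (S T : Module.End K V) :
    Module.finrank K (LinearMap.ker (S * T)) ≤
      Module.finrank K (LinearMap.ker S) + Module.finrank K (LinearMap.ker T) := by
  let U : LinearMap.ker (S * T) →ₗ[K] LinearMap.ker S :=
    (T.comp (LinearMap.ker (S * T)).subtype).codRestrict _ fun v => v.2
  have h := LinearMap.finrank_range_add_finrank_ker U
  have h1 : Module.finrank K (LinearMap.range U) ≤ Module.finrank K (LinearMap.ker S) :=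
    Submodule.finrank_le _
  have h2 : Module.finrank K (LinearMap.ker U) ≤ Module.finrank K (LinearMap.ker T) := by
    let W : LinearMap.ker U →ₗ[K] LinearMap.ker T :=
      ((LinearMap.ker (S * T)).subtype.comp (LinearMap.ker U).subtype).codRestrict _ fun v =>
        congrArg Subtype.val v.2
    refine LinearMap.finrank_le_finrank_of_injective (f := W) fun v w hvw => ?_
    have h3 : ((v : LinearMap.ker (S * T)) : V) = (w : LinearMap.ker (S * T)) :=
      congrArg (fun x : LinearMap.ker T => (x : V)) hvw
    exact Subtype.ext (Subtype.ext h3)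
  omega

section

variable (h : 0 < orderOf (φ : F →+* F))
include h

/-- A nonzero kernel element splits off a linear right factor, which accounts for at most one
dimension. -/
theorem finrank_ker_act_le {a : F} (ha : a ≠ 0) {f : SkewPolynomial F} (hf : f ≠ 0) :
    Module.finrank (fixedField F) (LinearMap.ker (act a f)) ≤ natDeg f := by
  have := (finrank_fixedField h).1
  induction hn : natDeg f generalizing f with
  | zero =>
    have hinj : LinearMap.ker (act a f) = ⊥ := by
      rw [LinearMap.ker_eq_bot']
      intro v hv
      have hc := coeff_natDeg_ne_zero hf
      rw [hn] at hc
      rw [eq_C_of_natDeg_eq_zero hn, act_C] at hv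
      exact (mul_eq_zero.1 hv).resolve_left hc
    rw [hinj, finrank_bot]
  | succ n ih =>
    by_cases hex : ∃ β ∈ LinearMap.ker (act a f), β ≠ 0
    · obtain ⟨β, hβ, hβ0⟩ := hex
      obtain ⟨G, rfl⟩ := (act_eq_zero_iff a hβ0 f).1 hβ
      have hG := left_ne_zero_of_mul hf
      rw [natDeg_mul hG (linear_ne_zero _), natDeg_linear] at hn
      rw [map_mul]
      have h1 := finrank_ker_mul_le (act a G) (act a (linear (φ β * a * β⁻¹)))
      have h2 := finrank_ker_act_linear_le a (φ β * a * β⁻¹) ha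
      have h3 := ih hG (by omega)
      omega
    · push Not at hex
      have : LinearMap.ker (act a f) = ⊥ := by
        rw [eq_bot_iff]
        exact fun v hv => hex v hv
      rw [this, finrank_bot]
      exact Nat.zero_le _

theorem normPoly_rightDvd_iff_act_eq_zero {a : F} (ha : a ≠ 0) (f : SkewPolynomial F) :
    RightDvd (normPoly (orderOf (φ : F →+* F)) a) f ↔ act a f = 0 := by
  constructor
  · rintro ⟨G, rfl⟩
    rw [map_mul, act_normPoly, mul_zero]
  · intro hf
    obtain ⟨q, r, rfl, h2⟩ := exists_eq_mul_add (normPoly_ne_zero h a) f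
    rw [map_add, map_mul, act_normPoly, mul_zero, zero_add] at hf
    rw [natDeg_normPoly h] at h2
    have hr : r = 0 := by
      by_contra hr
      have h3 := finrank_ker_act_le h ha hr
      rw [hf, LinearMap.ker_zero, finrank_top, (finrank_fixedField h).2] at h3
      have := natDeg_lt_of_mem_degLT hr h2
      omega
    exact ⟨q, by rw [hr, add_zero]⟩

theorem normPoly_rightDvd_iff_forall_isZero {a : F} (ha : a ≠ 0) (f : SkewPolynomial F) :
    RightDvd (normPoly (orderOf (φ : F →+* F)) a) f ↔ ∀ c ∈ conjClass a, IsZero f c := by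
  rw [normPoly_rightDvd_iff_act_eq_zero h ha]
  constructor
  · rintro hf c ⟨β, hβ, rfl⟩
    rw [← act_eq_zero_iff a hβ, hf]
    rfl
  · intro hf
    ext β
    by_cases hβ : β = 0
    · rw [hβ, map_zero, map_zero]
    · exact (act_eq_zero_iff a hβ f).2 (hf _ ⟨β, hβ, rfl⟩)

/-- A right divisor of `x^m - N(a)` has a kernel of maximal dimension. -/
theorem natDeg_le_finrank_ker_act {a : F} (ha : a ≠ 0) {D : SkewPolynomial F}
    (hD : RightDvd D (normPoly (orderOf (φ : F →+* F)) a)) :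
    natDeg D ≤ Module.finrank (fixedField F) (LinearMap.ker (act a D)) := by
  have hfin := (finrank_fixedField h).1
  obtain ⟨S, hS⟩ := hD
  have hp := normPoly_ne_zero h a
  rw [hS] at hp
  have hS0 := left_ne_zero_of_mul hp
  -- The product `S * D` acts as zero, so `m ≤ dim ker S + dim ker D`, while `dim ker S ≤ deg S = m
  -- - deg D`.
  have h1 := finrank_ker_mul_le (act a S) (act a D)
  rw [← map_mul, ← hS, act_normPoly, LinearMap.ker_zero, finrank_top,
    (finrank_fixedField h).2] at h1
  have h2 := finrank_ker_act_le h ha hS0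
  have h3 := natDeg_normPoly h a
  rw [hS, natDeg_mul hS0 (right_ne_zero_of_mul hp)] at h3
  omega

/-- A right divisor of `x^m - N(a)` with at most one zero has degree at most one. -/
theorem natDeg_le_one_of_unique_zero {a : F} (ha : a ≠ 0) {D : SkewPolynomial F}
    (hD : RightDvd D (normPoly (orderOf (φ : F →+* F)) a)) {c : F}
    (hc : ∀ b, IsZero D b → b = c) : natDeg D ≤ 1 := by
  have hfin := (finrank_fixedField h).1
  refine (natDeg_le_finrank_ker_act h ha hD).trans
    ((Submodule.finrank_mono fun v hv => ?_).trans (finrank_ker_act_linear_le a c ha))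
  by_cases hv0 : v = 0
  · rw [hv0]; exact zero_mem _
  · have := hc _ ((act_eq_zero_iff a hv0 D).1 hv)
    rw [LinearMap.mem_ker, act_eq_zero_iff a hv0, this]
    exact RightDvd.refl _

/-- A form of Hilbert 90: `x - b` divides `x^m - N(a)`, so it kills some `β ≠ 0`, and the conjugate
of `a` by `β` must be `b`. -/
theorem mem_conjClass_of_isZero_normPoly {a b : F} (ha : a ≠ 0)
    (hb : IsZero (normPoly (orderOf (φ : F →+* F)) a) b) : b ∈ conjClass a := by
  have h1 := natDeg_le_finrank_ker_act h ha hb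
  rw [natDeg_linear] at h1
  have := (finrank_fixedField h).1
  have : LinearMap.ker (act a (linear b)) ≠ ⊥ := by
    intro h2
    rw [h2, finrank_bot] at h1
    omega
  obtain ⟨β, hβ, hβ0⟩ := Submodule.exists_mem_ne_zero_of_ne_bot this
  exact ⟨β, hβ0, (eq_of_isZero_linear ((act_eq_zero_iff a hβ0 _).1 hβ)).symm⟩

theorem norm_mem_fixedField (a : F) : φ (norm (orderOf (φ : F →+* F)) a) =
    norm (orderOf (φ : F →+* F)) a := by
  rw [norm, map_prod]
  simp_rw [← Function.iterate_succ_apply' φ]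
  obtain ⟨n, hn⟩ := Nat.exists_eq_add_of_le' h
  rw [hn, Finset.prod_range_succ, Finset.prod_range_succ', Nat.succ_eq_add_one, ← hn,
    iterate_φ_orderOf]
  rfl

/-- `X ^ m` commutes with constants because `φ^[m]` is the identity, and the norm commutes with `X`
because it is fixed by `φ`. -/
theorem normPoly_mem_center (a : F) : normPoly (orderOf (φ : F →+* F)) a ∈
    Subring.center (SkewPolynomial F) := by
  rw [Subring.mem_center_iff]
  intro g
  induction g using SkewPolynomial.induction with
  | h0 => rw [zero_mul, mul_zero]
  | ha n r q _ _ ih =>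
    rw [add_mul, mul_add, ih, normPoly]
    congr 1
    have hfix : φ^[n] (norm (orderOf (φ : F →+* F)) a) = norm (orderOf (φ : F →+* F)) a :=
      Function.iterate_fixed (norm_mem_fixedField h a) n
    rw [mul_sub, sub_mul, monomial_mul_X_pow, X_pow_mul_monomial, iterate_φ_orderOf,
      monomial_mul_C, C_mul_monomial, hfix, mul_comm r]

theorem normPoly_commute (a : F) (g : SkewPolynomial F) :
    g * normPoly (orderOf (φ : F →+* F)) a = normPoly (orderOf (φ : F →+* F)) a * g :=
  Subring.mem_center_iff.1 (normPoly_mem_center h a) g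

theorem normPoly_mem_fixedPolySubring (a : F) : normPoly (orderOf (φ : F →+* F)) a ∈
    fixedPolySubring F (orderOf (φ : F →+* F)) :=
  sub_mem (Subring.subset_closure (Set.mem_insert _ _))
    (Subring.subset_closure (Set.mem_insert_of_mem _ ⟨_, norm_mem_fixedField h a, rfl⟩))

end

/-! ### Products of linear skew polynomials -/

theorem linearProd_append_singleton (l : List F) (b : F) :
    linearProd (l ++ [b]) = linear b * linearProd l := by
  induction l with
  | nil => simp [linearProd]
  | cons a l ih => rw [List.cons_append, linearProd, linearProd, ih, mul_assoc]

theorem linearProd_ne_zero (l : List F) : linearProd l ≠ 0 := by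
  induction l with
  | nil => exact one_ne_zero
  | cons a l ih => exact mul_ne_zero ih (linear_ne_zero a)

theorem natDeg_linearProd (l : List F) : natDeg (linearProd l) = l.length := by
  induction l with
  | nil => exact natDeg_one
  | cons a l ih =>
    rw [linearProd, natDeg_mul (linearProd_ne_zero l) (linear_ne_zero a), ih, natDeg_linear,
      List.length_cons]

theorem exists_isZero_of_natDeg_eq_one {E : SkewPolynomial F} (hE : natDeg E = 1) :
    ∃ e, IsZero E e := by
  have hE0 : E ≠ 0 := by
    rintro rfl
    rw [natDeg_zero] at hE
    omega
  have h1 : E.coeff 1 ≠ 0 := hE ▸ coeff_natDeg_ne_zero hE0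
  -- The zero comes from `c₁ x + c₀ = c₁ (x + c₁⁻¹ c₀)`.
  refine ⟨-(E.coeff 1)⁻¹ * E.coeff 0, C (E.coeff 1), SkewPolynomial.ext fun n => ?_⟩
  rw [linear, mul_sub, coeff_sub, ← C_mul, C_mul_X_eq_monomial, coeff_monomial]
  rcases n with _ | _ | n
  · rw [coeff_C_zero, if_neg one_ne_zero]
    field_simp
    ring
  · rw [coeff_C_succ, if_pos rfl, sub_zero]
  · rw [coeff_C_succ, if_neg (by omega), sub_zero]
    exact mem_degLT_natDeg_succ E _ (by omega)

/-- A non-constant right divisor of a product of linear skew polynomials has a zero. -/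
theorem exists_isZero_of_rightDvd_linearProd (l : List F) {D : SkewPolynomial F}
    (hD : RightDvd D (linearProd l)) (hd : 0 < natDeg D) : ∃ b, IsZero D b := by
  induction l generalizing D with
  | nil => exact absurd (natDeg_eq_zero_of_rightDvd_one hD) hd.ne'
  | cons a l ih =>
    have hD0 := ne_zero_of_rightDvd hD (linearProd_ne_zero _)
    obtain ⟨E, hEa, hED, hE⟩ := exists_gcrd (linear a) D
    have hE1 := natDeg_le_of_rightDvd hEa (linear_ne_zero a)
    rw [natDeg_linear] at hE1
    by_cases hE2 : natDeg E = 1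
    · exact ⟨a, (rightDvd_symm hEa (linear_ne_zero a) (by rw [natDeg_linear, hE2])).trans hED⟩
    -- Here `E` is constant, so `D'` keeps the degree of `D` while dividing the shorter product, and
    -- induction gives it a zero `b`.
    obtain ⟨D', hD'0, hD', hdeg⟩ := exists_colon hD0 (linear a)
    have h1 := hdeg E hEa hED hE
    obtain ⟨b, D'', hb⟩ := ih ((hD' _).2 hD) (by omega)
    have hDD : RightDvd D (D'' * (linear b * linear a)) := by
      rw [← mul_assoc, ← hb]
      exact (hD' _).1 (RightDvd.refl _)
    have hD''0 : D'' ≠ 0 := by rintro rfl; exact hD'0 (by rw [hb, zero_mul])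
    have h2 : natDeg D' = natDeg D'' + 1 := by
      rw [hb, natDeg_mul hD''0 (linear_ne_zero b), natDeg_linear]
    have hh0 : linear b * linear a ≠ 0 := mul_ne_zero (linear_ne_zero b) (linear_ne_zero a)
    have hh2 : natDeg (linear b * linear a) = 2 := by
      rw [natDeg_mul (linear_ne_zero b) (linear_ne_zero a), natDeg_linear, natDeg_linear]
    -- Since `D` divides `D'' * (linear b * linear a)`, `Q` divides `D''` and has degree below `deg
    -- D`. So the gcrd `E'` of `D` with the quadratic is not constant; in degree one or two it
    -- yields a zero.
    obtain ⟨Q, _, hQ, hQdeg⟩ := exists_colon hD0 (linear b * linear a)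
    obtain ⟨E', hEh, hED', hE'⟩ := exists_gcrd (linear b * linear a) D
    have h3 := hQdeg E' hEh hED' hE'
    have h4 := natDeg_le_of_rightDvd ((hQ _).2 hDD) hD''0
    have h5 := natDeg_le_of_rightDvd hEh hh0
    by_cases h6 : natDeg E' = 2
    · have h7 : RightDvd (linear b * linear a) D :=
        (rightDvd_symm hEh hh0 (by rw [h6, hh2])).trans hED'
      exact ⟨a, RightDvd.trans ⟨linear b, rfl⟩ h7⟩
    · obtain ⟨e, he⟩ := exists_isZero_of_natDeg_eq_one (E := E') (by omega)
      exact ⟨e, he.trans hED'⟩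

/-! ### Divisors of powers of a central skew polynomial -/

/-- Multiplying the Bézout identity by the central `p ^ n` shows that a divisor of `p ^ (n + 1)`
divides `p ^ n`; descend to `p ^ 0 = 1`. -/
theorem natDeg_eq_zero_of_rightDvd_pow_of_coprime {p P : SkewPolynomial F} (hc : ∀ g, g * p = p * g)
    {u v : SkewPolynomial F} (huv : 1 = u * P + v * p) {n : ℕ} (h : RightDvd P (p ^ n)) :
    natDeg P = 0 := by
  induction n with
  | zero => exact natDeg_eq_zero_of_rightDvd_one (by rwa [pow_zero] at h)
  | succ n ih =>
    apply ih
    have h1 : p ^ n = p ^ n * u * P + v * p ^ (n + 1) := by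
      have h2 : p ^ n * v = v * p ^ n := (((show Commute v p from hc v).pow_right n).eq).symm
      calc p ^ n = p ^ n * (u * P + v * p) := by rw [← huv, mul_one]
        _ = _ := by rw [mul_add, ← mul_assoc, ← mul_assoc, h2, mul_assoc v, ← pow_succ]
    rw [h1]
    exact RightDvd.add ⟨_, rfl⟩ (h.mul_left v)

theorem one_of_gcrd_natDeg_eq_zero {D f g : SkewPolynomial F} (hD : D ≠ 0) (h : natDeg D = 0)
    (hfg : ∃ u v, D = u * f + v * g) : ∃ u v, 1 = u * f + v * g := by
  obtain ⟨u, v, huv⟩ := hfg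
  obtain ⟨G, hG⟩ := rightDvd_of_natDeg_eq_zero hD h 1
  exact ⟨G * u, G * v, by rw [mul_assoc, mul_assoc, ← mul_add, ← huv, hG]⟩

theorem isZero_of_isZero_pow {p : SkewPolynomial F} (hc : ∀ g, g * p = p * g) {n : ℕ} {b : F}
    (h : IsZero (p ^ n) b) : IsZero p b := by
  obtain ⟨D, hDb, hDp, hD⟩ := exists_gcrd (linear b) p
  have hD0 := ne_zero_of_rightDvd hDb (linear_ne_zero b)
  have h1 := natDeg_le_of_rightDvd hDb (linear_ne_zero b)
  rw [natDeg_linear] at h1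
  by_cases h2 : natDeg D = 0
  · obtain ⟨u, v, huv⟩ := one_of_gcrd_natDeg_eq_zero hD0 h2 hD
    have := natDeg_eq_zero_of_rightDvd_pow_of_coprime hc huv h
    rw [natDeg_linear] at this
    omega
  · exact (rightDvd_symm hDb (linear_ne_zero b) (by rw [natDeg_linear]; omega)).trans hDp

theorem rightDvd_pow_of_mul {p P D : SkewPolynomial F} (hc : ∀ g, g * p = p * g) {k : ℕ}
    (hP : RightDvd P (p ^ k)) (hD : RightDvd D p) : RightDvd (P * D) (p ^ (k + 1)) := by
  obtain ⟨H, hH⟩ := hP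
  obtain ⟨E, hE⟩ := hD
  refine ⟨E * H, ?_⟩
  have h2 : p ^ k * E = E * p ^ k := (((show Commute E p from hc E).pow_right k).eq).symm
  calc p ^ (k + 1) = p ^ k * E * D := by rw [pow_succ, mul_assoc, ← hE]
    _ = _ := by rw [h2, hH]; noncomm_ring

/-- If `U P D = p^N`, then centrality gives `p^N D = D U P D`, and `D` cancels: the left factor `P`
is itself a right divisor. -/
theorem rightDvd_pow_of_mul_right {p P D : SkewPolynomial F} (hc : ∀ g, g * p = p * g)
    (hD : D ≠ 0) {N : ℕ} (h : RightDvd (P * D) (p ^ N)) : RightDvd P (p ^ N) := by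
  obtain ⟨U, hU⟩ := h
  refine ⟨D * U, mul_right_cancel₀ hD ?_⟩
  have h2 : p ^ N * D = D * p ^ N := (((show Commute D p from hc D).pow_right N).eq).symm
  rw [h2]
  conv_lhs => rw [hU]
  noncomm_ring

/-- A right divisor `P` of some power of a central `p` divides `p ^ deg P`. -/
theorem rightDvd_pow_natDeg {p P : SkewPolynomial F} (hc : ∀ g, g * p = p * g) (hP : P ≠ 0)
    {N : ℕ} (h : RightDvd P (p ^ N)) : RightDvd P (p ^ natDeg P) := by
  induction hn : natDeg P using Nat.strong_induction_on generalizing P with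
  | _ n ih =>
    by_cases h0 : natDeg P = 0
    · exact rightDvd_of_natDeg_eq_zero hP h0 _
    obtain ⟨D, hDP, hDp, hD⟩ := exists_gcrd P p
    have hD0 := ne_zero_of_rightDvd hDP hP
    have hDd : natDeg D ≠ 0 := fun h1 => by
      obtain ⟨u, v, huv⟩ := one_of_gcrd_natDeg_eq_zero hD0 h1 hD
      exact h0 (natDeg_eq_zero_of_rightDvd_pow_of_coprime hc huv h)
    obtain ⟨S, rfl⟩ := hDP
    have hS := left_ne_zero_of_mul hP
    rw [natDeg_mul hS hD0] at hn
    have h1 := ih (natDeg S) (by omega) hS (rightDvd_pow_of_mul_right hc hD0 h) rfl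
    have h2 := rightDvd_pow_of_mul hc h1 hDp
    obtain ⟨k, rfl⟩ := Nat.exists_eq_add_of_le (show natDeg S + 1 ≤ n by omega)
    rw [add_comm, pow_add]
    exact h2.mul_left _

/-- A product of `r` linear skew polynomials that divides `p ^ r` but not `p ^ (r - 1)` has only
one zero. -/
theorem eq_of_isZero_of_not_rightDvd {p P : SkewPolynomial F} (hc : ∀ g, g * p = p * g)
    (hP : P ≠ 0) {n N : ℕ} (hd : natDeg P = n + 1) (h : RightDvd P (p ^ N))
    (hn : ¬ RightDvd P (p ^ n)) {b c : F} (hb : IsZero P b) (hc' : IsZero P c) : b = c := by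
  by_contra hbc
  apply hn
  obtain ⟨D, hDP, hDp, u, v, huv⟩ := exists_gcrd P p
  have hD0 := ne_zero_of_rightDvd hDP hP
  have hzero : ∀ e, IsZero P e → IsZero D e := fun e he => by
    have h1 : IsZero p e := isZero_of_isZero_pow hc (he.trans h)
    rw [huv]
    exact RightDvd.add (he.mul_left u) (h1.mul_left v)
  -- Two distinct zeros cannot both belong to a gcrd of degree at most one. With `P = S * D`, this
  -- leaves `natDeg S + 1 ≤ n`, so `P` already divides `p ^ n`.
  have hD1 : 1 < natDeg D := by
    by_contra hlt
    have h1 : RightDvd D (linear b) :=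
      rightDvd_symm (hzero b hb) hD0 (by rw [natDeg_linear]; omega)
    exact hbc (eq_of_isZero_linear ((hzero c hc').trans h1)).symm
  obtain ⟨S, rfl⟩ := hDP
  have hS := left_ne_zero_of_mul hP
  rw [natDeg_mul hS hD0] at hd
  have h1 := rightDvd_pow_natDeg hc hS (rightDvd_pow_of_mul_right hc hD0 h)
  have h2 := rightDvd_pow_of_mul hc h1 hDp
  obtain ⟨k, rfl⟩ := Nat.exists_eq_add_of_le (show natDeg S + 1 ≤ n by omega)
  rw [add_comm, pow_add]
  exact h2.mul_left _

/-! ### Multiplicities and powers of `x^m - N(a)` -/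

section

variable (h : 0 < orderOf (φ : F →+* F))
include h

theorem isZero_normPoly_of_mem_conjClass {a c : F} (ha : a ≠ 0) (hc : c ∈ conjClass a) :
    IsZero (normPoly (orderOf (φ : F →+* F)) a) c :=
  (normPoly_rightDvd_iff_forall_isZero h ha _).1 (RightDvd.refl _) c hc

theorem exists_linearProd_rightDvd_pow {a c : F} (ha : a ≠ 0) (hc : c ∈ conjClass a) (n : ℕ) :
    ∃ l : List F, l.length = n + 1 ∧ l.head? = some c ∧
      RightDvd (linearProd l) (normPoly (orderOf (φ : F →+* F)) a ^ (n + 1)) ∧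
      ¬ RightDvd (linearProd l) (normPoly (orderOf (φ : F →+* F)) a ^ n) := by
  induction n with
  | zero =>
    refine ⟨[c], rfl, rfl, ?_, fun h1 => ?_⟩
    · rw [zero_add, pow_one, linearProd, linearProd, one_mul]
      exact isZero_normPoly_of_mem_conjClass h ha hc
    · rw [pow_zero] at h1
      have := natDeg_eq_zero_of_rightDvd_one h1
      rw [natDeg_linearProd, List.length_singleton] at this
      omega
  | succ n ih =>
    obtain ⟨l, hl, hhead, ⟨S, hS⟩, hn⟩ := ih
    set p := normPoly (orderOf (φ : F →+* F)) a
    have hp : p ≠ 0 := normPoly_ne_zero h a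
    -- Were `p` a factor of the cofactor `S`, it could be cancelled and `linearProd l` would divide
    -- `p ^ n`. Hence some conjugate `b` is not a zero of `S`, and `linear b` is the factor to add.
    have hS' : ¬ RightDvd p S := by
      rintro ⟨T, rfl⟩
      refine hn ⟨T, mul_right_cancel₀ hp ?_⟩
      rw [← pow_succ, hS, mul_assoc, mul_assoc, normPoly_commute h]
    rw [normPoly_rightDvd_iff_forall_isZero h ha] at hS'
    push Not at hS'
    obtain ⟨b, hb, hbS⟩ := hS'
    refine ⟨l ++ [b], by simp [hl], ?_, ?_, ?_⟩
    · rw [List.head?_append, hhead]; rfl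
    · rw [linearProd_append_singleton]
      obtain ⟨T, hT⟩ := isZero_normPoly_of_mem_conjClass h ha hb
      refine ⟨S * T, ?_⟩
      have h3 : S * T * linear b = S * p := by rw [mul_assoc, ← hT]
      rw [← mul_assoc, h3, normPoly_commute h, mul_assoc, ← hS, pow_succ']
    · rw [linearProd_append_singleton]
      rintro ⟨G, hG⟩
      refine hbS ⟨G, mul_right_cancel₀ (linearProd_ne_zero l) ?_⟩
      rw [← hS, hG, mul_assoc]

theorem isZeroOfMultiplicity_of_rightDvd {a : F} (ha : a ≠ 0) {r : ℕ} (hr : 0 < r)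
    {f : SkewPolynomial F} (hf : RightDvd (normPoly (orderOf (φ : F →+* F)) a ^ r) f)
    {c : F} (hc : c ∈ conjClass a) : IsZeroOfMultiplicity f c r := by
  obtain ⟨n, rfl⟩ := Nat.exists_eq_add_of_le' hr
  obtain ⟨l, hl, hhead, h1, h2⟩ := exists_linearProd_rightDvd_pow h ha hc n
  refine ⟨l, hl, hhead, ?_, h1.trans hf⟩
  obtain _ | ⟨c', l⟩ := l
  · exact absurd hhead (by simp)
  obtain rfl : c' = c := by simpa using hhead
  intro b
  have hc0 : IsZero (linearProd (c' :: l)) c' := ⟨_, rfl⟩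
  constructor
  · intro hb
    exact eq_of_isZero_of_not_rightDvd (normPoly_commute h a) (linearProd_ne_zero _)
      (by rw [natDeg_linearProd, hl]) h1 h2 hb hc0
  · rintro rfl
    exact hc0

/-- The hypothesis asks only for a `P` whose nonconstant right divisors all vanish at `c`, not for a
product of linear factors: this property passes at once to right divisors such as `Q`, so the
induction closes. -/
theorem pow_normPoly_rightDvd_of_unique_zero {a : F} (ha : a ≠ 0) {B : Set F}
    (hB : B ⊆ conjClass a)
    (hvan : ∀ f, (∀ c ∈ B, IsZero f c) → RightDvd (normPoly (orderOf (φ : F →+* F)) a) f)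
    (r : ℕ) {f : SkewPolynomial F}
    (hf : ∀ c ∈ B, ∃ P, P ≠ 0 ∧ natDeg P = r ∧
      (∀ D, RightDvd D P → 0 < natDeg D → IsZero D c) ∧ (∀ b, IsZero P b → b = c) ∧
      RightDvd P f) :
    RightDvd (normPoly (orderOf (φ : F →+* F)) a ^ r) f := by
  induction r generalizing f with
  | zero => exact ⟨f, by rw [pow_zero, mul_one]⟩
  | succ r ih =>
    obtain ⟨g, rfl⟩ := hvan f fun c hc => by
      obtain ⟨P, _, hd, hloc, _, hPf⟩ := hf c hc
      exact (hloc P (RightDvd.refl P) (by omega)).trans hPf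
    obtain ⟨G, hG⟩ := ih (f := g) fun c hc => by
      obtain ⟨P, hP, hd, hloc, huniq, hPf⟩ := hf c hc
      obtain ⟨Q, hQ0, hQ, hQdeg⟩ := exists_colon hP (normPoly (orderOf (φ : F →+* F)) a)
      have hQP : RightDvd Q P := by
        rw [hQ, normPoly_commute h]
        exact (RightDvd.refl P).mul_left _
      obtain ⟨D, hDp, hDP, hD⟩ := exists_gcrd (normPoly (orderOf (φ : F →+* F)) a) P
      have hD0 := ne_zero_of_rightDvd hDP hP
      have h1 := hQdeg D hDp hDP hD
      have h2 := natDeg_le_one_of_unique_zero h ha hDp fun b hb => huniq b (hb.trans hDP)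
      have h3 : IsZero D c := by
        obtain ⟨u, v, huv⟩ := hD
        rw [huv]
        exact RightDvd.add ((isZero_normPoly_of_mem_conjClass h ha (hB hc)).mul_left u)
          ((hloc P (RightDvd.refl P) (by omega)).mul_left v)
      have h4 := natDeg_le_of_rightDvd h3 hD0
      rw [natDeg_linear] at h4
      exact ⟨Q, hQ0, by omega, fun E hE => hloc E (hE.trans hQP),
        fun b hb => huniq b (hb.trans hQP), (hQ g).2 hPf⟩
    exact ⟨G, by rw [hG, pow_succ, mul_assoc]⟩

/-- The product of a multiplicity sequence has the required property: a nonconstant right divisor of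
it has some zero, which can only be `c`. -/
theorem pow_normPoly_rightDvd {a : F} (ha : a ≠ 0) {B : Set F} (hB : B ⊆ conjClass a)
    (hvan : ∀ f, (∀ c ∈ B, IsZero f c) → RightDvd (normPoly (orderOf (φ : F →+* F)) a) f)
    {r : ℕ} {f : SkewPolynomial F} (hf : ∀ c ∈ B, IsZeroOfMultiplicity f c r) :
    RightDvd (normPoly (orderOf (φ : F →+* F)) a ^ r) f := by
  refine pow_normPoly_rightDvd_of_unique_zero h ha hB hvan r fun c hc => ?_
  obtain ⟨l, hl, hhead, hmul, hdvd⟩ := hf c hc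
  obtain _ | ⟨c', l⟩ := l
  · exact hmul.elim
  obtain rfl : c' = c := by simpa using hhead
  refine ⟨_, linearProd_ne_zero _, by rw [natDeg_linearProd, hl], fun D hD hd => ?_,
    fun b hb => (hmul b).1 hb, hdvd⟩
  obtain ⟨b, hb⟩ := exists_isZero_of_rightDvd_linearProd _ hD hd
  have : b = c' := (hmul b).1 (hb.trans hD)
  exact this ▸ hb

end

/-! ### P-bases of conjugacy classes -/

theorem mem_vanishingIdeal_linearSet {S : Set F} {f : SkewPolynomial F} :
    f ∈ vanishingIdeal (linearSet S) ↔ ∀ c ∈ S, IsZero f c :=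
  Set.forall_mem_image

theorem mem_linearSet {S : Set F} {c : F} : linear c ∈ linearSet S ↔ c ∈ S :=
  linear_injective.mem_set_image

theorem mem_classicalPoints (c : F) : linear c ∈ classicalPoints := mem_linearSet.2 trivial

theorem subset_pClosure {U Ω : Set (SkewPolynomial F)} (h : Ω ⊆ U) : Ω ⊆ pClosure U Ω :=
  fun P hP => ⟨h hP, fun _ hf => hf P hP⟩

theorem mem_conjClass_self (a : F) : a ∈ conjClass a := ⟨1, one_ne_zero, by simp⟩

theorem IsPBasisOfConjClass.subset {a : F} {B : Set F} (hB : IsPBasisOfConjClass a B) :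
    B ⊆ conjClass a := fun c hc => by
  obtain ⟨_, ⟨hBU, _⟩, _, hcl⟩ := hB
  have h1 := subset_pClosure hBU (mem_linearSet.2 hc)
  rw [← hcl] at h1
  exact mem_linearSet.1 h1

theorem C_mem_center {c : F} (hc : φ c = c) : C c ∈ Subring.center (SkewPolynomial F) := by
  rw [Subring.mem_center_iff]
  intro g
  induction g using SkewPolynomial.induction with
  | h0 => rw [zero_mul, mul_zero]
  | ha n r q _ _ ih =>
    rw [add_mul, mul_add, ih, monomial_mul_C, C_mul_monomial, Function.iterate_fixed hc, mul_comm]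

section

variable (h : 0 < orderOf (φ : F →+* F))
include h

theorem pClosure_linearSet_eq {a : F} (ha : a ≠ 0) {S : Set F}
    (hS : ∀ f, (∀ c ∈ S, IsZero f c) ↔ RightDvd (normPoly (orderOf (φ : F →+* F)) a) f) :
    pClosure classicalPoints (linearSet S) = linearSet (conjClass a) := by
  ext P
  constructor
  · rintro ⟨⟨b, _, rfl⟩, hP⟩
    refine mem_linearSet.2 (mem_conjClass_of_isZero_normPoly h ha ?_)
    exact hP _ (mem_vanishingIdeal_linearSet.2 ((hS _).2 (RightDvd.refl _)))
  · rintro ⟨c, hc, rfl⟩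
    refine ⟨mem_classicalPoints c, fun f hf => ?_⟩
    exact (isZero_normPoly_of_mem_conjClass h ha hc).trans
      ((hS f).1 (mem_vanishingIdeal_linearSet.1 hf))

theorem IsPBasisOfConjClass.normPoly_rightDvd {a : F} (ha : a ≠ 0) {B : Set F}
    (hB : IsPBasisOfConjClass a B) {f : SkewPolynomial F} (hf : ∀ c ∈ B, IsZero f c) :
    RightDvd (normPoly (orderOf (φ : F →+* F)) a) f := by
  rw [normPoly_rightDvd_iff_forall_isZero h ha]
  intro c hc
  have h1 := mem_linearSet.2 hc
  rw [hB.2.2.2] at h1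
  exact h1.2 f (mem_vanishingIdeal_linearSet.2 hf)

/-- The P-basis consists of the conjugates of `a` by a `K`-basis of `F`. Equal conjugates would make
two basis vectors proportional over `K`, so there are `m` of them, and their minimal skew polynomial
is `x^m - N(a)`. -/
theorem exists_isPBasisOfConjClass {a : F} (ha : a ≠ 0) :
    ∃ B : Set F, IsPBasisOfConjClass a B := by
  set m := orderOf (φ : F →+* F) with hm
  obtain ⟨hfin, hrank⟩ := finrank_fixedField h
  let e := Module.finBasis (fixedField F) F
  let g : Fin (Module.finrank (fixedField F) F) → F := fun i => φ (e i) * a * (e i)⁻¹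
  have hinj : Function.Injective g := by
    intro i j hij
    by_contra hne
    have hi := e.ne_zero i
    have hj := e.ne_zero j
    have hfix : φ (e i / e j) = e i / e j := by
      have hφj : φ (e j) ≠ 0 := (map_ne_zero _).2 hj
      simp only [g] at hij
      rw [← div_eq_mul_inv, ← div_eq_mul_inv, div_eq_div_iff hi hj] at hij
      rw [map_div₀, div_eq_div_iff hφj hj]
      apply mul_left_cancel₀ ha
      linear_combination hij
    have h1 : e i = (⟨e i / e j, hfix⟩ : fixedField F) • e j := (div_mul_cancel₀ _ hj).symm
    have h2 := congrArg (fun x => e.repr x i) h1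
    simp [Ne.symm hne] at h2
  have hmem : ∀ i, g i ∈ conjClass a := fun i => ⟨e i, e.ne_zero i, rfl⟩
  have hvan : ∀ f, (∀ c ∈ Set.range g, IsZero f c) ↔ RightDvd (normPoly m a) f := by
    intro f
    rw [Set.forall_mem_range]
    constructor
    · intro hf
      rw [normPoly_rightDvd_iff_act_eq_zero h ha]
      refine e.ext fun i => ?_
      exact (act_eq_zero_iff a (e.ne_zero i) f).2 (hf i)
    · intro hf i
      exact (normPoly_rightDvd_iff_forall_isZero h ha f).1 hf _ (hmem i)
  have hvan' : ∀ f, (∀ c ∈ conjClass a, IsZero f c) ↔ RightDvd (normPoly m a) f := fun f =>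
    (normPoly_rightDvd_iff_forall_isZero h ha f).symm
  have hfinite : (linearSet (Set.range g)).Finite := (Set.finite_range g).image _
  refine ⟨Set.range g, ⟨?_, pClosure_linearSet_eq h ha hvan'⟩, ⟨?_, ?_⟩, ⟨hfinite, normPoly m a,
    ⟨?_, ⟨m, ?_, normPoly_coeff h a⟩, ?_⟩, ?_⟩, (pClosure_linearSet_eq h ha hvan).symm⟩
  · rintro _ ⟨c, _, rfl⟩
    exact mem_classicalPoints c
  · rintro _ ⟨c, _, rfl⟩
    exact mem_classicalPoints c
  · refine fun s _ hs => ⟨id, Function.injective_id.injOn, fun Q hQ => ⟨?_, RightDvd.refl Q⟩⟩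
    obtain ⟨_, ⟨i, rfl⟩, rfl⟩ := hs hQ
    exact mem_linearSet.2 (hmem i)
  · exact mem_vanishingIdeal_linearSet.2 ((hvan _).2 (RightDvd.refl _))
  · rw [degree_eq_natDeg (normPoly_ne_zero h a), natDeg_normPoly h]
  · intro Q hQ hQ0
    rw [degree_eq_natDeg hQ0, degree_eq_natDeg (normPoly_ne_zero h a)]
    exact WithBot.coe_le_coe.2
      (natDeg_le_of_rightDvd ((hvan Q).1 (mem_vanishingIdeal_linearSet.1 hQ)) hQ0)
  · have h1 : ∀ Q ∈ hfinite.toFinset, degree Q = 1 := by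
      intro Q hQ
      obtain ⟨c, _, rfl⟩ := hfinite.mem_toFinset.1 hQ
      rw [degree_eq_natDeg (linear_ne_zero c), natDeg_linear]
      rfl
    have h2 : hfinite.toFinset.card = m := by
      rw [← Set.ncard_eq_toFinset_card _ hfinite, linearSet,
        Set.ncard_image_of_injective _ linear_injective, ← Set.image_univ,
        Set.ncard_image_of_injective _ hinj, Set.ncard_univ, Nat.card_eq_fintype_card,
        Fintype.card_fin, hrank]
    rw [Finset.sum_congr rfl h1, Finset.sum_const, h2, nsmul_one,
      degree_eq_natDeg (normPoly_ne_zero h a), natDeg_normPoly h]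

/-! ### Several conjugacy classes -/

/-- `x^m - N(a)` as an element of the center. -/
def centralNormPoly (a : F) : Subring.center (SkewPolynomial F) :=
  ⟨normPoly (orderOf (φ : F →+* F)) a, normPoly_mem_center h a⟩

/-- The two polynomials differ by the constant `N(b) - N(a)` of `K`. If it were zero, `b` would be a
zero of `x^m - N(a)`, hence conjugate to `a`. -/
theorem isCoprime_centralNormPoly {a b : F} (ha : a ≠ 0) (hb : b ≠ 0) (hab : b ∉ conjClass a) :
    IsCoprime (centralNormPoly h a) (centralNormPoly h b) := by
  set d := norm (orderOf (φ : F →+* F)) b - norm (orderOf (φ : F →+* F)) a with hd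
  have hd0 : d ≠ 0 := by
    intro h0
    refine hab (mem_conjClass_of_isZero_normPoly h ha ?_)
    rw [normPoly, ← sub_eq_zero.1 h0]
    exact isZero_normPoly_of_mem_conjClass h hb (mem_conjClass_self b)
  have hfix : φ d⁻¹ = d⁻¹ := by
    rw [map_inv₀, hd, map_sub, norm_mem_fixedField h, norm_mem_fixedField h]
  let u : Subring.center (SkewPolynomial F) := ⟨C d⁻¹, C_mem_center hfix⟩
  refine ⟨u, -u, Subtype.ext ?_⟩
  change C d⁻¹ * normPoly _ a + -C d⁻¹ * normPoly _ b = 1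
  rw [neg_mul, ← sub_eq_add_neg, ← mul_sub, normPoly, normPoly, sub_sub_sub_cancel_left, ← C_sub,
    ← C_mul, inv_mul_cancel₀ hd0, C_1]

end

theorem rightDvd_mul_of_isCoprime {z w : Subring.center (SkewPolynomial F)} (hzw : IsCoprime z w)
    {f : SkewPolynomial F} (hz : RightDvd (z : SkewPolynomial F) f)
    (hw : RightDvd (w : SkewPolynomial F) f) :
    RightDvd ((z * w : Subring.center (SkewPolynomial F)) : SkewPolynomial F) f := by
  obtain ⟨G, hG⟩ := hz
  obtain ⟨H, hH⟩ := hw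
  obtain ⟨u, v, huv⟩ := hzw
  have h1 : (u * z + v * w : SkewPolynomial F) = 1 := congrArg Subtype.val huv
  refine ⟨H * u + G * v, ?_⟩
  have hc : ∀ (x : Subring.center (SkewPolynomial F)) (g : SkewPolynomial F), g * x = x * g :=
    fun x => Subring.mem_center_iff.1 x.2
  calc f = f * (u * z) + f * (v * w) := by rw [← mul_add, h1, mul_one]
    _ = H * w * (u * z) + G * z * (v * w) := by rw [← hG, ← hH]
    _ = H * u * (z * w) + G * v * (z * w) := by
      congr 1
      · rw [mul_assoc, ← hc w (u * z : SkewPolynomial F)]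
        noncomm_ring
      · rw [mul_assoc, ← mul_assoc (z : SkewPolynomial F), ← hc z]
        noncomm_ring
    _ = _ := by rw [← add_mul]; rfl

theorem rightDvd_prod_of_isCoprime {ι : Type*} (s : Finset ι)
    {z : ι → Subring.center (SkewPolynomial F)} (hz : ∀ i j, i ≠ j → IsCoprime (z i) (z j))
    {f : SkewPolynomial F} (hf : ∀ i ∈ s, RightDvd (z i : SkewPolynomial F) f) :
    RightDvd ((∏ i ∈ s, z i : Subring.center (SkewPolynomial F)) : SkewPolynomial F) f := by
  classical
  induction s using Finset.induction_on with
  | empty => exact ⟨f, (mul_one f).symm⟩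
  | insert i s hi ih =>
    rw [Finset.prod_insert hi]
    refine rightDvd_mul_of_isCoprime (IsCoprime.prod_right fun j hj => hz i j ?_)
      (hf i (Finset.mem_insert_self i s)) (ih fun j hj => hf j (Finset.mem_insert_of_mem hj))
    rintro rfl
    exact hi hj

theorem natDeg_coe_prod {ι : Type*} (s : Finset ι) {z : ι → Subring.center (SkewPolynomial F)}
    (hz : ∀ i, (z i : SkewPolynomial F) ≠ 0) :
    ((∏ i ∈ s, z i : Subring.center (SkewPolynomial F)) : SkewPolynomial F) ≠ 0 ∧
      natDeg ((∏ i ∈ s, z i : Subring.center (SkewPolynomial F)) : SkewPolynomial F) =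
        ∑ i ∈ s, natDeg (z i : SkewPolynomial F) := by
  classical
  induction s using Finset.induction_on with
  | empty => exact ⟨one_ne_zero, natDeg_one⟩
  | insert i s hi ih =>
    rw [Finset.prod_insert hi, Finset.sum_insert hi, Subring.coe_mul, ← ih.2]
    exact ⟨mul_ne_zero (hz i) ih.1, natDeg_mul (hz i) ih.1⟩

end

end SkewMult

/-! ### Assembly of the equivalences and of the degree bound. -/

theorem mainTheorem7 {F : Type*} [Field F] [MulSemiringAction (Multiplicative ℕ) F]
    (m : ℕ) (hm : 0 < m) (hσ : orderOf (φ : F →+* F) = m) (f : SkewPolynomial F) :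
    (∀ (a : F) (r : ℕ), a ≠ 0 → 0 < r →
      SkewMult.normPoly m a ^ r ∈ Subring.center (SkewPolynomial F) ∧
      SkewMult.normPoly m a ^ r ∈ SkewMult.fixedPolySubring F m ∧
      List.TFAE [
        ∀ c ∈ SkewMult.conjClass a, SkewMult.IsZeroOfMultiplicity f c r,
        ∃ B : Set F, SkewMult.IsPBasisOfConjClass a B ∧
          ∀ c ∈ B, SkewMult.IsZeroOfMultiplicity f c r,
        ∀ B : Set F, SkewMult.IsPBasisOfConjClass a B →
          ∀ c ∈ B, SkewMult.IsZeroOfMultiplicity f c r,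
        ∃ G : SkewPolynomial F, f = G * SkewMult.normPoly m a ^ r,
        ∃ G : SkewPolynomial F, f = SkewMult.normPoly m a ^ r * G]) ∧
    (∀ (k : ℕ) (a : Fin k → F) (r : Fin k → ℕ), (∀ i, a i ≠ 0) → (∀ i, 0 < r i) →
      (∀ i j, i ≠ j → a j ∉ SkewMult.conjClass (a i)) → f ≠ 0 →
      (∀ i, ∀ c ∈ SkewMult.conjClass (a i), SkewMult.IsZeroOfMultiplicity f c (r i)) →
        ((m * ∑ i, r i : ℕ) : WithBot ℕ) ≤ SkewMult.degree f ∧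
        (((m * ∑ i, r i : ℕ) : WithBot ℕ) = SkewMult.degree f ↔
          ∃ b : F, b ≠ 0 ∧
            f = C b * (List.ofFn fun i => SkewMult.normPoly m (a i) ^ r i).prod)) := by
  subst hσ
  refine ⟨fun a r ha hr => ?_, fun k a r ha _ hconj hf0 hf => ?_⟩
  · have hcen := pow_mem (SkewMult.normPoly_mem_center hm a) r
    refine ⟨hcen, pow_mem (SkewMult.normPoly_mem_fixedPolySubring hm a) r, ?_⟩
    tfae_have 1 → 3 := fun h1 B hB c hc => h1 c (SkewMult.IsPBasisOfConjClass.subset hB hc)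
    tfae_have 3 → 2 := fun h3 => by
      obtain ⟨B, hB⟩ := SkewMult.exists_isPBasisOfConjClass hm ha
      exact ⟨B, hB, h3 B hB⟩
    tfae_have 2 → 4 := fun ⟨B, hB, h2⟩ =>
      SkewMult.pow_normPoly_rightDvd hm ha (SkewMult.IsPBasisOfConjClass.subset hB)
        (fun g hg => SkewMult.IsPBasisOfConjClass.normPoly_rightDvd hm ha hB hg) h2
    tfae_have 4 → 1 := fun h4 c hc => SkewMult.isZeroOfMultiplicity_of_rightDvd hm ha hr h4 hc
    tfae_have 4 ↔ 5 :=
      exists_congr fun G => by rw [Subring.mem_center_iff.1 hcen G]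
    tfae_finish
  · let z : Fin k → Subring.center (SkewPolynomial F) := fun i =>
      SkewMult.centralNormPoly hm (a i) ^ r i
    have hz : ∀ i, (z i : SkewPolynomial F) =
      SkewMult.normPoly (orderOf (φ : F →+* F)) (a i) ^ r i := fun i => rfl
    have hz0 : ∀ i, (z i : SkewPolynomial F) ≠ 0 := fun i =>
      pow_ne_zero _ (SkewMult.normPoly_ne_zero hm (a i))
    -- The ordered product in the noncommutative ring is the image of a product over `Fin k` in the
    -- commutative center, where coprimality is available.
    have hprod : (List.ofFn fun i =>
        SkewMult.normPoly (orderOf (φ : F →+* F)) (a i) ^ r i).prod =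
        ((∏ i, z i : Subring.center (SkewPolynomial F)) : SkewPolynomial F) := by
      have h1 := map_list_prod (Subring.center (SkewPolynomial F)).subtype (List.ofFn z)
      rw [List.map_ofFn, List.prod_ofFn] at h1
      exact h1.symm
    obtain ⟨hp0, hpdeg⟩ := SkewMult.natDeg_coe_prod Finset.univ hz0
    have hsum : ∑ i, SkewMult.natDeg (z i : SkewPolynomial F) =
        orderOf (φ : F →+* F) * ∑ i, r i := by
      rw [Finset.mul_sum]
      refine Finset.sum_congr rfl fun i _ => ?_
      rw [hz, SkewMult.natDeg_pow (SkewMult.normPoly_ne_zero hm (a i)),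
        SkewMult.natDeg_normPoly hm, mul_comm]
    rw [hsum] at hpdeg
    have hdvd := SkewMult.rightDvd_prod_of_isCoprime Finset.univ (z := z) (f := f)
      (fun i j hij => (SkewMult.isCoprime_centralNormPoly hm (ha i) (ha j) (hconj i j hij)).pow)
      (fun i _ => SkewMult.pow_normPoly_rightDvd hm (ha i) subset_rfl
        (fun g => (SkewMult.normPoly_rightDvd_iff_forall_isZero hm (ha i) g).2) (hf i))
    rw [hprod, SkewMult.degree_eq_natDeg hf0, ← hpdeg]
    refine ⟨WithBot.coe_le_coe.2 (SkewMult.natDeg_le_of_rightDvd hdvd hf0), ?_⟩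
    constructor
    · intro heq
      have heq' : SkewMult.natDeg _ = SkewMult.natDeg f := WithBot.coe_injective heq
      obtain ⟨G, rfl⟩ := hdvd
      have hG0 := left_ne_zero_of_mul hf0
      rw [SkewMult.natDeg_mul hG0 hp0] at heq'
      have hG := SkewMult.eq_C_of_natDeg_eq_zero (f := G) (by omega)
      refine ⟨G.coeff 0, fun h0 => hG0 ?_, by rw [← hG]⟩
      rw [hG, h0, C_0]
    · rintro ⟨b, hb, rfl⟩
      rw [SkewMult.natDeg_mul (mt C_eq_zero.1 hb) hp0, SkewMult.natDeg_C, zero_add]
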